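/- Let $R$ be a Gorenstein local ring (that is, a commutative Noetherian local ring of finite injective dimension over itself) of Krull dimension one, and let $I$ be an ideal of $R$ containing a regular element (a non-zero-divisor of $R$). Then the ring $\operatorname{End}_R(I)$ of $R$-linear endomorphisms of $I$ is commutative. Suppose that $I$ is rigid, that is, $\operatorname{Ext}^1_R(I,I)=0$, and that $\operatorname{End}_R(I)$ is a Gorenstein ring, that is, it is Noetherian and its localization at every maximal ideal is a Gorenstein local ring. Then $I$ is a principal ideal. -/

import Mathlib

open CategoryTheory

universe u

/-- A Noetherian local ring is Gorenstein if it has finite injective dimension as a module over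
itself. -/
class IsGorensteinLocalRing (R : Type u) [CommRing R] : Prop
    extends IsLocalRing R, IsNoetherianRing R where
  exists_hasInjectiveDimensionLE : ∃ n : ℕ, HasInjectiveDimensionLE (ModuleCat.of R R) n

/-- A (not necessarily local) Noetherian commutative ring is Gorenstein if its localization at
every maximal ideal is a Gorenstein local ring. -/
class IsGorensteinRing (R : Type u) [CommRing R] : Prop extends IsNoetherianRing R where
  localization_atPrime : ∀ (m : Ideal R) [m.IsMaximal],
    IsGorensteinLocalRing (Localization.AtPrime m)

/-- A module `M` over `R` is rigid if `Ext¹_R(M, M) = 0`. -/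
def IsRigidModule (R : Type u) [CommRing R] (M : Type u) [AddCommGroup M] [Module R M] : Prop :=
  Subsingleton (Abelian.Ext.{u} (ModuleCat.of R M) (ModuleCat.of R M) 1)

/-- Endomorphisms of an ideal that contains a regular element commute. -/
theorem Ideal.end_mul_comm {R : Type u} [CommRing R] {I : Ideal R}
    (hI : ∃ x ∈ I, x ∈ nonZeroDivisors R) (f g : Module.End R I) : f * g = g * f := by
  obtain ⟨x, hxI, hx⟩ := hI
  have key : ∀ (h : Module.End R I) (y : I), x * (h y : R) = (y : R) * (h ⟨x, hxI⟩ : R) := by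
    intro h y
    have e : x • y = (y : R) • (⟨x, hxI⟩ : I) := Subtype.ext (mul_comm x (y : R))
    have e' := congrArg (fun z : I => (z : R)) (congrArg h e)
    simpa only [map_smul, Submodule.coe_smul, smul_eq_mul] using e'
  ext y
  have hfg : x * (x * (f (g y) : R)) = x * (x * (g (f y) : R)) := by
    rw [key f (g y), key g (f y), ← mul_assoc, ← mul_assoc, key g y, key f y]
    ring
  exact (mul_cancel_left_mem_nonZeroDivisors hx).1
    ((mul_cancel_left_mem_nonZeroDivisors hx).1 hfg)

/-- The endomorphism ring `End_R(I)` of an ideal `I` that contains a regular element, with its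
usual ring structure, as a commutative ring. -/
abbrev Ideal.endCommRing {R : Type u} [CommRing R] (I : Ideal R)
    (hI : ∃ x ∈ I, x ∈ nonZeroDivisors R) : CommRing (Module.End R I) :=
  { (inferInstance : Ring (Module.End R I)) with
    mul_comm := Ideal.end_mul_comm hI }

/-!
Let `x ∈ I` be regular. Since `Ext¹(I, I) = 0`, every map `I → I / x I` lifts to an endomorphism
of `I`. As endomorphisms commute, lifting maps that factor through `I / 𝔪 I` shows that
`E = End_R(I)` acts on `I / 𝔪 I` by scalars, so `E` is local.

Over `E` put `M = I` and suppose that all maps `M → E` take values in the maximal ideal. Let `z`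
represent a socle element of `E / x E`. Maps from submodules of `M` to `E / x E` lift to `E`,
because `E` is Gorenstein of dimension one, and this forces `z M ⊆ x M`. So `z / x` is an
endomorphism of `M`, that is, `z ∈ x E`, a contradiction. Hence some `f : M → E` takes a unit
value `f m`. For `n ∈ M` the endomorphism `y ↦ f y • n` is multiplication by an element of `E`, so
`M = E m`. Finally `E` acts by scalars modulo `𝔪 M`, so `M = R m` by Nakayama.
-/

open Abelian IsLocalRing Pointwise

section Ext

variable {R : Type u} [CommRing R]

theorem subsingleton_ext_X₁ {S : ShortComplex (ModuleCat.{u} R)} (hS : S.ShortExact)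
    {N : ModuleCat.{u} R} {i : ℕ} (h₂ : Subsingleton (Ext.{u} S.X₂ N i))
    (h₃ : Subsingleton (Ext.{u} S.X₃ N (i + 1))) : Subsingleton (Ext.{u} S.X₁ N i) := by
  refine subsingleton_of_forall_eq 0 fun e ↦ ?_
  obtain ⟨e₂, rfl⟩ := Ext.contravariant_sequence_exact₁ hS N e (add_comm 1 i) (h₃.elim _ _)
  rw [h₂.elim e₂ 0, Ext.comp_zero]

theorem subsingleton_ext_X₂ {S : ShortComplex (ModuleCat.{u} R)} (hS : S.ShortExact)
    {N : ModuleCat.{u} R} {i : ℕ} (h₁ : Subsingleton (Ext.{u} S.X₁ N i))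
    (h₃ : Subsingleton (Ext.{u} S.X₃ N i)) : Subsingleton (Ext.{u} S.X₂ N i) := by
  refine subsingleton_of_forall_eq 0 fun e ↦ ?_
  obtain ⟨e₃, rfl⟩ := Ext.contravariant_sequence_exact₂ hS N e (h₁.elim _ _)
  rw [h₃.elim e₃ 0, Ext.comp_zero]

variable {M N : Type u} [AddCommGroup M] [Module R M] [AddCommGroup N] [Module R N] {x : R}

theorem exists_mkQ_comp_eq_of_subsingleton_ext (hx : IsSMulRegular N x)
    (h : Subsingleton (Ext.{u} (ModuleCat.of R M) (ModuleCat.of R N) 1))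
    (φ : M →ₗ[R] QuotSMulTop x N) :
    ∃ ψ : M →ₗ[R] N, (x • (⊤ : Submodule R N)).mkQ ∘ₗ ψ = φ := by
  have hN : IsSMulRegular (ModuleCat.of R N) x := hx
  obtain ⟨e, he⟩ := Ext.covariant_sequence_exact₃ (ModuleCat.of R M)
    hN.smulShortComplex_shortExact (Ext.mk₀ (ModuleCat.ofHom φ)) (zero_add 1) (h.elim _ _)
  obtain ⟨ψ, rfl⟩ := Ext.addEquiv₀.symm.surjective e
  rw [Ext.addEquiv₀_symm_apply, Ext.mk₀_comp_mk₀] at he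
  exact ⟨ψ.hom, congrArg ModuleCat.Hom.hom (Ext.addEquiv₀.symm.injective he)⟩

theorem exists_eq_smul_of_forall_mem_smul_top (hx : IsSMulRegular N x) (f : M →ₗ[R] N)
    (hf : ∀ m, f m ∈ x • (⊤ : Submodule R N)) : ∃ g : M →ₗ[R] N, x • g = f := by
  have hinj : Function.Injective (LinearMap.lsmul R N x) := hx
  have hrange : ∀ m, f m ∈ LinearMap.range (LinearMap.lsmul R N x) := fun m ↦ by
    obtain ⟨n, -, hn⟩ := hf m
    exact ⟨n, hn⟩
  exact ⟨f.codRestrictOfInjective _ hinj hrange, f.codRestrictOfInjective_comp _ hinj hrange⟩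

theorem subsingleton_ext_one_of_quotSMulTop [IsLocalRing R] [IsNoetherianRing R]
    [Module.Finite R M] [Module.Finite R N] (hxm : x ∈ maximalIdeal R) (hx : IsSMulRegular M x)
    (h : Subsingleton (Ext.{u} (ModuleCat.of R (QuotSMulTop x M)) (ModuleCat.of R N) 2)) :
    Subsingleton (Ext.{u} (ModuleCat.of R M) (ModuleCat.of R N) 1) := by
  have hM : IsSMulRegular (ModuleCat.of R M) x := hx
  have hdiv : ∀ e : Ext.{u} (ModuleCat.of R M) (ModuleCat.of R N) 1, ∃ e', x • e' = e := by
    intro e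
    obtain ⟨e', rfl⟩ : ∃ e' : Ext.{u} (ModuleCat.of R M) (ModuleCat.of R N) 1,
        (Ext.mk₀ (x • 𝟙 (ModuleCat.of R M))).comp e' (zero_add 1) = e :=
      Ext.contravariant_sequence_exact₁ hM.smulShortComplex_shortExact _ e rfl (h.elim _ _)
    exact ⟨e', by rw [Ext.mk₀_smul, Ext.smul_comp, Ext.mk₀_id_comp]⟩
  have htop : (⊤ : Submodule R (Ext.{u} (ModuleCat.of R M) (ModuleCat.of R N) 1)) ≤
      maximalIdeal R • ⊤ := fun e _ ↦ by
    obtain ⟨e', rfl⟩ := hdiv e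
    exact Submodule.smul_mem_smul hxm Submodule.mem_top
  exact (Submodule.subsingleton_iff R).1 (subsingleton_of_bot_eq_top
    (Submodule.eq_bot_of_le_smul_of_le_jacobson_bot _ _ Module.Finite.fg_top htop
      (maximalIdeal_le_jacobson _)).symm)

end Ext

section FiniteLength

variable {R : Type u} [CommRing R]

section Quotient

variable (x : R) [IsArtinianRing (R ⧸ Ideal.span {x})] (M : Type*)
  [AddCommGroup M] [Module R M] [Module.Finite R M]

theorem isArtinian_quotSMulTop : IsArtinian R (QuotSMulTop x M) := by
  have : Module.Finite (R ⧸ Ideal.span {x}) (QuotSMulTop x M) := .of_restrictScalars_finite R _ _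
  exact isArtinian_of_surjective_algebraMap
    (Ideal.Quotient.mk_surjective (I := Ideal.span {x}))

theorem isFiniteLength_quotSMulTop [IsNoetherianRing R] : IsFiniteLength R (QuotSMulTop x M) :=
  isFiniteLength_iff_isNoetherian_isArtinian.2 ⟨inferInstance, isArtinian_quotSMulTop x M⟩

end Quotient

theorem subsingleton_ext_quotSMulTop_self {x : R} (hx : IsSMulRegular R x) (N : ModuleCat.{u} R)
    (i : ℕ) : Subsingleton (Ext.{u} (ModuleCat.of R (QuotSMulTop x R)) N (i + 2)) := by
  have hR : IsSMulRegular (ModuleCat.of R R) x := hx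
  have : Projective (ModuleCat.of R R) := (IsProjective.iff_projective R).1 inferInstance
  have : HasProjectiveDimensionLT (ModuleCat.of R (QuotSMulTop x R)) 2 :=
    hR.smulShortComplex_shortExact.hasProjectiveDimensionLT_X₃ 1
      (inferInstanceAs (HasProjectiveDimensionLT (ModuleCat.of R R) 1))
      (inferInstanceAs (HasProjectiveDimensionLT (ModuleCat.of R R) 2))
  exact HasProjectiveDimensionLT.subsingleton _ 2 _ (Nat.le_add_left 2 i) N

variable [IsLocalRing R]

theorem exists_injective_of_isSimpleModule (T Q : Type*) [AddCommGroup T] [Module R T]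
    [AddCommGroup Q] [Module R Q] [IsSimpleModule R T] [Nontrivial Q] [IsArtinian R Q] :
    ∃ f : T →ₗ[R] Q, Function.Injective f := by
  obtain ⟨S, hS⟩ := IsAtomic.exists_atom (Submodule R Q)
  have : IsSimpleModule R S := isSimpleModule_iff_isAtom.2 hS
  obtain ⟨I, hI, ⟨e⟩⟩ := isSimpleModule_iff_quot_maximal.1 ‹IsSimpleModule R T›
  obtain ⟨J, hJ, ⟨e'⟩⟩ := isSimpleModule_iff_quot_maximal.1 ‹IsSimpleModule R S›
  obtain rfl := (eq_maximalIdeal hI).trans (eq_maximalIdeal hJ).symm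
  exact ⟨S.subtype ∘ₗ (e.trans e'.symm).toLinearMap,
    S.injective_subtype.comp (e.trans e'.symm).injective⟩

theorem subsingleton_ext_of_isFiniteLength [IsNoetherianRing R] {x : R}
    (hx : IsSMulRegular R x) (hxm : x ∈ maximalIdeal R) [IsArtinianRing (R ⧸ Ideal.span {x})]
    (N : ModuleCat.{u} R) (d : ℕ) [HasInjectiveDimensionLE N d] (M : Type u) [AddCommGroup M]
    [Module R M] (hM : IsFiniteLength R M) (i : ℕ) :
    Subsingleton (Ext.{u} (ModuleCat.of R M) N (i + 2)) := by
  have : IsArtinian R (QuotSMulTop x R) := isArtinian_quotSMulTop x R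
  have : Nontrivial (QuotSMulTop x R) := nontrivial_quotSMulTop_of_mem_maximalIdeal R hxm
  -- Descending induction on the degree, from `i = d` where `Ext` vanishes: a simple module embeds
  -- into `R / x R`, which has projective dimension at most one.
  suffices H : ∀ k i : ℕ, d ≤ i + k → ∀ (M : Type u) [AddCommGroup M] [Module R M],
      IsFiniteLength R M →
      Subsingleton (Ext.{u} (ModuleCat.of R M) N (i + 2)) from
    H d i (Nat.le_add_left d i) M hM
  intro k
  induction k with
  | zero => exact fun i hi M _ _ _ ↦ HasInjectiveDimensionLT.subsingleton N (d + 1) _ (by lia) _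
  | succ k ih =>
    intro i hi M _ _ hM
    have simple (T : Type u) [AddCommGroup T] [Module R T] [IsSimpleModule R T] :
        Subsingleton (Ext.{u} (ModuleCat.of R T) N (i + 2)) := by
      obtain ⟨f, hf⟩ := exists_injective_of_isSimpleModule (R := R) T (QuotSMulTop x R)
      exact subsingleton_ext_X₁
        (ModuleCat.shortComplex_shortExact (ModuleCat.shortComplexOfCompEqZero f
          (LinearMap.range f).mkQ f.exact_map_mkQ_range.linearMap_comp_eq_zero)
          f.exact_map_mkQ_range hf (Submodule.mkQ_surjective _))
        (subsingleton_ext_quotSMulTop_self hx N i)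
        (ih (i + 1) (by lia) _
          ((isFiniteLength_quotSMulTop x R).of_surjective (Submodule.mkQ_surjective _)))
    induction hM with
    | @of_subsingleton M =>
      have := (ModuleCat.isZero_of_subsingleton (ModuleCat.of R M)).hasProjectiveDimensionLT_zero
      exact HasProjectiveDimensionLT.subsingleton _ 0 _ (Nat.zero_le _) N
    | @of_simple_quotient M _ _ L _ _ ihL =>
      exact subsingleton_ext_X₂
        (ModuleCat.shortComplex_shortExact (ModuleCat.shortComplexOfCompEqZero L.subtype L.mkQ
          (LinearMap.exact_subtype_mkQ L).linearMap_comp_eq_zero)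
          (LinearMap.exact_subtype_mkQ L) L.injective_subtype L.mkQ_surjective) ihL (simple _)

theorem subsingleton_ext_one_of_hasInjectiveDimensionLE [IsNoetherianRing R] {x : R}
    (hxR : IsSMulRegular R x) (hxm : x ∈ maximalIdeal R) [IsArtinianRing (R ⧸ Ideal.span {x})]
    {M N : Type u} [AddCommGroup M] [Module R M] [Module.Finite R M] [AddCommGroup N] [Module R N]
    [Module.Finite R N] (hxM : IsSMulRegular M x) (d : ℕ)
    [HasInjectiveDimensionLE (ModuleCat.of R N) d] :
    Subsingleton (Ext.{u} (ModuleCat.of R M) (ModuleCat.of R N) 1) :=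
  subsingleton_ext_one_of_quotSMulTop hxm hxM <|
    subsingleton_ext_of_isFiniteLength hxR hxm _ d _ (isFiniteLength_quotSMulTop x M) 0

end FiniteLength

theorem isSimpleModule_residueField (R : Type*) [CommRing R] [IsLocalRing R] :
    IsSimpleModule R (ResidueField R) :=
  isSimpleModule_iff_quot_maximal.2 ⟨maximalIdeal R, inferInstance, ⟨.refl R _⟩⟩

section MapsToArtinian

variable {R : Type*} [CommRing R] [IsLocalRing R] {M Q : Type*} [AddCommGroup M] [Module R M]
  [AddCommGroup Q] [Module R Q] [Nontrivial Q] [IsArtinian R Q] {N : Submodule R M}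

variable (Q) in
theorem exists_le_ker_apply_ne_zero (hN : maximalIdeal R • ⊤ ≤ N) {w : M} (hw : w ∉ N) :
    ∃ φ : M →ₗ[R] Q, N ≤ LinearMap.ker φ ∧ φ w ≠ 0 := by
  have htors : Module.IsTorsionBySet R (M ⧸ N) (maximalIdeal R : Set R) := by
    rintro v ⟨a, ha⟩
    obtain ⟨v, rfl⟩ := N.mkQ_surjective v
    exact (Submodule.Quotient.mk_eq_zero N).2 (hN (Submodule.smul_mem_smul ha Submodule.mem_top))
  let : Module (ResidueField R) (M ⧸ N) := htors.module
  have : IsScalarTower R (ResidueField R) (M ⧸ N) := htors.isScalarTower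
  have hw' : N.mkQ w ≠ 0 := fun h ↦ hw ((Submodule.Quotient.mk_eq_zero N).1 h)
  obtain ⟨f, hf⟩ := Module.Projective.exists_dual_ne_zero (ResidueField R) hw'
  have := isSimpleModule_residueField R
  obtain ⟨ι, hι⟩ := exists_injective_of_isSimpleModule (R := R) (ResidueField R) Q
  refine ⟨ι ∘ₗ f.restrictScalars R ∘ₗ N.mkQ, fun n hn ↦ ?_,
    fun h ↦ hf (hι (h.trans ι.map_zero.symm))⟩
  simp [(Submodule.Quotient.mk_eq_zero N).2 hn]

variable (Q) in
theorem exists_ne_zero_le_ker [Module.Finite R M] (hN : N ≠ ⊤) :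
    ∃ φ : M →ₗ[R] Q, φ ≠ 0 ∧ N ≤ LinearMap.ker φ := by
  have hlt : N ⊔ maximalIdeal R • ⊤ ≠ ⊤ := fun h ↦ hN <| top_le_iff.1 <|
    Submodule.le_of_le_smul_of_le_jacobson_bot Module.Finite.fg_top (maximalIdeal_le_jacobson _)
      h.ge
  obtain ⟨w, -, hw⟩ := SetLike.exists_of_lt hlt.lt_top
  obtain ⟨φ, hφ, hφw⟩ := exists_le_ker_apply_ne_zero Q le_sup_right hw
  exact ⟨φ, fun h ↦ hφw (by simp [h]), le_sup_left.trans hφ⟩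

end MapsToArtinian

section Divisibility

variable {S : Type*} [CommRing S] {x : S}

theorem mkQ_eq_zero_iff_dvd {a : S} : (x • (⊤ : Submodule S S)).mkQ a = 0 ↔ x ∣ a := by
  rw [Submodule.mkQ_apply, Submodule.Quotient.mk_eq_zero, Submodule.mem_smul_pointwise_iff_exists]
  simp only [Submodule.mem_top, true_and, smul_eq_mul, dvd_iff_exists_eq_mul_right, eq_comm]

theorem span_singleton_eq_top_of_isUnit_apply {M : Type*} [AddCommGroup M] [Module S M]
    (hM : Function.Surjective (algebraMap S (Module.End S M))) {f : M →ₗ[S] S} {m : M}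
    (hf : IsUnit (f m)) : Submodule.span S {m} = ⊤ := by
  refine Submodule.eq_top_iff'.2 fun m' ↦ ?_
  obtain ⟨s, hs⟩ := hM (f.smulRight m')
  have hsm : s • m = f m • m' := LinearMap.congr_fun hs m
  refine ((Submodule.span S {m}).smul_mem_iff_of_isUnit hf).1 ?_
  exact hsm ▸ Submodule.smul_mem _ s (Submodule.mem_span_singleton_self m)

variable [IsLocalRing S]

theorem exists_not_dvd_forall_dvd_mul (hxm : x ∈ maximalIdeal S)
    [IsArtinianRing (S ⧸ Ideal.span {x})] :
    ∃ z : S, ¬ x ∣ z ∧ ∀ a ∈ maximalIdeal S, x ∣ a * z := by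
  have : IsArtinian S (QuotSMulTop x S) := isArtinian_quotSMulTop x S
  have : Nontrivial (QuotSMulTop x S) := nontrivial_quotSMulTop_of_mem_maximalIdeal S hxm
  have := isSimpleModule_residueField S
  obtain ⟨ι, hι⟩ :=
    exists_injective_of_isSimpleModule (R := S) (ResidueField S) (QuotSMulTop x S)
  obtain ⟨z, hz⟩ := Submodule.mkQ_surjective _ (ι 1)
  refine ⟨z, fun hdvd ↦ ?_, fun a ha ↦ ?_⟩
  · rw [← mkQ_eq_zero_iff_dvd, hz, map_eq_zero_iff ι hι] at hdvd
    exact one_ne_zero hdvd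
  · have ha1 : a • (1 : ResidueField S) = 0 := by
      rw [← Algebra.algebraMap_eq_smul_one]
      exact (residue_eq_zero_iff a).2 ha
    rw [← mkQ_eq_zero_iff_dvd, ← smul_eq_mul, map_smul, hz, ← map_smul, ha1, map_zero]

end Divisibility

section Scalars

variable {S M : Type u} [CommRing S] [IsLocalRing S] [IsNoetherianRing S] [AddCommGroup M]
  [Module S M] [Module.Finite S M] {x : S}

theorem smul_mem_smul_top_of_forall_apply_mem_maximalIdeal (hxS : IsSMulRegular S x)
    (hxm : x ∈ maximalIdeal S) [IsArtinianRing (S ⧸ Ideal.span {x})] (d : ℕ)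
    [HasInjectiveDimensionLE (ModuleCat.of S S) d] (hxM : IsSMulRegular M x)
    (htr : ∀ (f : M →ₗ[S] S) m, f m ∈ maximalIdeal S) {z : S}
    (hz : ∀ a ∈ maximalIdeal S, x ∣ a * z) (m : M) : z • m ∈ x • (⊤ : Submodule S M) := by
  have : IsArtinian S (QuotSMulTop x S) := isArtinian_quotSMulTop x S
  have : Nontrivial (QuotSMulTop x S) := nontrivial_quotSMulTop_of_mem_maximalIdeal S hxm
  -- Otherwise some `φ ≠ 0` from `P = x M + z M` to `S / x S` kills `x M`. For a lift `ψ : P → S` of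
  -- `φ`, the map `f = x⁻¹ ψ(x ·)` satisfies `ψ (z m) = z f(m) ∈ x S`, so `φ` kills `z M` as well.
  let P : Submodule S M := x • ⊤ ⊔ z • ⊤
  let u : M →ₗ[S] P := (LinearMap.lsmul S M x).codRestrict P fun m ↦
    Submodule.mem_sup_left (Submodule.smul_mem_pointwise_smul m x ⊤ Submodule.mem_top)
  let v : M →ₗ[S] P := (LinearMap.lsmul S M z).codRestrict P fun m ↦
    Submodule.mem_sup_right (Submodule.smul_mem_pointwise_smul m z ⊤ Submodule.mem_top)
  suffices hu : LinearMap.range u = ⊤ by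
    obtain ⟨m', hm'⟩ := LinearMap.range_eq_top.1 hu (v m)
    have : x • m' = z • m := congrArg Subtype.val hm'
    exact this ▸ Submodule.smul_mem_pointwise_smul m' x ⊤ Submodule.mem_top
  by_contra hu
  obtain ⟨φ, hφ, hφu⟩ := exists_ne_zero_le_ker (QuotSMulTop x S) hu
  obtain ⟨ψ, rfl⟩ := exists_mkQ_comp_eq_of_subsingleton_ext hxS
    (subsingleton_ext_one_of_hasInjectiveDimensionLE hxS hxm (hxM.submodule P x) d) φ
  have hψu (m : M) : ψ (u m) ∈ x • (⊤ : Submodule S S) :=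
    (Submodule.Quotient.mk_eq_zero _).1 (hφu (LinearMap.mem_range_self u m))
  obtain ⟨f, hf⟩ := exists_eq_smul_of_forall_mem_smul_top hxS (ψ ∘ₗ u) hψu
  have hψv (m : M) : ψ (v m) = f m * z := by
    have huv : x • v m = z • u m := Subtype.ext (smul_comm x z m)
    have hfu : x * f m = ψ (u m) := LinearMap.congr_fun hf m
    refine hxS ?_
    calc x * ψ (v m) = ψ (x • v m) := (map_smul ψ x _).symm
      _ = z * ψ (u m) := by rw [huv, map_smul, smul_eq_mul]
      _ = x * (f m * z) := by rw [← hfu]; ring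
  refine hφ (LinearMap.ext fun ⟨p, hp⟩ ↦ ?_)
  obtain ⟨_, ⟨a, -, rfl⟩, _, ⟨b, -, rfl⟩, rfl⟩ := Submodule.mem_sup.1 hp
  have hab : (⟨_, hp⟩ : P) = u a + v b := rfl
  have hvb : (x • (⊤ : Submodule S S)).mkQ (ψ (v b)) = 0 :=
    mkQ_eq_zero_iff_dvd.2 (hψv b ▸ hz _ (htr f b))
  rw [hab, map_add, hφu (LinearMap.mem_range_self u a), LinearMap.comp_apply, hvb, add_zero,
    LinearMap.zero_apply]

theorem exists_span_singleton_eq_top_of_bijective_algebraMap_end (hxS : IsSMulRegular S x)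
    (hxm : x ∈ maximalIdeal S) [IsArtinianRing (S ⧸ Ideal.span {x})] (d : ℕ)
    [HasInjectiveDimensionLE (ModuleCat.of S S) d] (hxM : IsSMulRegular M x)
    (hM : Function.Bijective (algebraMap S (Module.End S M))) :
    ∃ m : M, Submodule.span S {m} = ⊤ := by
  obtain ⟨f, m, hf⟩ : ∃ (f : M →ₗ[S] S) (m : M), IsUnit (f m) := by
    by_contra! htr
    obtain ⟨z, hxz, hz⟩ := exists_not_dvd_forall_dvd_mul hxm
    obtain ⟨g, hg⟩ := exists_eq_smul_of_forall_mem_smul_top hxM (algebraMap S (Module.End S M) z)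
      (smul_mem_smul_top_of_forall_apply_mem_maximalIdeal hxS hxm d hxM htr hz)
    obtain ⟨s, rfl⟩ := hM.2 g
    have hsz : algebraMap S (Module.End S M) (x * s) = algebraMap S _ z := by rw [map_mul]; exact hg
    exact hxz ⟨s, (hM.1 hsz).symm⟩
  exact ⟨m, span_singleton_eq_top_of_isUnit_apply hM.2 hf⟩

end Scalars

section Rigid

variable {R M : Type u} [CommRing R] [IsLocalRing R] [AddCommGroup M] [Module R M]

theorem IsRigidModule.apply_mem_span_singleton_sup {x : R} (hrigid : IsRigidModule R M)
    (hx : IsSMulRegular M x) [Nontrivial (QuotSMulTop x M)] [IsArtinian R (QuotSMulTop x M)]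
    {e : Module.End R M} (he : e ∈ Subring.center (Module.End R M)) (y : M) :
    e y ∈ R ∙ y ⊔ maximalIdeal R • ⊤ := by
  by_contra hey
  obtain ⟨φ, hφ, hφe⟩ := exists_le_ker_apply_ne_zero (QuotSMulTop x M) le_sup_right hey
  obtain ⟨ψ, rfl⟩ := exists_mkQ_comp_eq_of_subsingleton_ext hx hrigid φ
  have hψy : ψ y ∈ x • (⊤ : Submodule R M) := (Submodule.Quotient.mk_eq_zero _).1
    (hφ (Submodule.mem_sup_left (Submodule.mem_span_singleton_self y)))
  obtain ⟨w, -, hw : x • w = ψ y⟩ := hψy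
  have hψe : ψ (e y) = x • e w := by
    rw [← map_smul, hw]
    exact LinearMap.congr_fun (Subring.mem_center_iff.1 he ψ) y
  refine hφe ((Submodule.Quotient.mk_eq_zero _).2 ?_)
  exact hψe ▸ Submodule.smul_mem_pointwise_smul (e w) x ⊤ Submodule.mem_top

end Rigid

section ScalarResidue

variable {R M : Type*} [CommRing R] [IsLocalRing R] [AddCommGroup M] [Module R M]
  {e : Module.End R M}

theorem exists_sub_smul_mem_of_forall_apply_mem_span_singleton_sup
    (he : ∀ y, e y ∈ R ∙ y ⊔ maximalIdeal R • ⊤) :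
    ∃ c : R, ∀ y, e y - c • y ∈ maximalIdeal R • (⊤ : Submodule R M) := by
  let P : Submodule R M := maximalIdeal R • ⊤
  let : Field (R ⧸ maximalIdeal R) := Ideal.Quotient.field _
  let eR : M ⧸ P →ₗ[R] M ⧸ P := P.mapQ P e (Submodule.smul_top_le_comap_smul_top _ e)
  let eV : M ⧸ P →ₗ[R ⧸ maximalIdeal R] M ⧸ P :=
    eR.extendScalarsOfSurjective Ideal.Quotient.mk_surjective
  have hdep (v : M ⧸ P) : ¬ LinearIndependent (R ⧸ maximalIdeal R) ![v, eV v] := by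
    obtain ⟨y, rfl⟩ := P.mkQ_surjective v
    obtain ⟨_, hay, p, hp, hap⟩ := Submodule.mem_sup.1 (he y)
    obtain ⟨a, rfl⟩ := Submodule.mem_span_singleton.1 hay
    have heV : eV (P.mkQ y) = Ideal.Quotient.mk (maximalIdeal R) a • P.mkQ y := by
      have : P.mkQ (e y) = a • P.mkQ y := by
        rw [← hap, map_add, map_smul, P.mkQ_apply p, (Submodule.Quotient.mk_eq_zero P).2 hp,
          add_zero]
      exact this
    intro hind
    have := (LinearIndependent.pair_iff.1 hind (Ideal.Quotient.mk _ a) (-1)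
      (by rw [heV, neg_one_smul, add_neg_cancel])).2
    exact one_ne_zero (neg_eq_zero.1 this)
  obtain ⟨c, hc⟩ := LinearMap.exists_eq_smul_id_of_forall_notLinearIndependent hdep
  obtain ⟨c, rfl⟩ := Ideal.Quotient.mk_surjective c
  refine ⟨c, fun y ↦ ?_⟩
  rw [← Submodule.Quotient.mk_eq_zero, Submodule.Quotient.mk_sub, sub_eq_zero]
  exact LinearMap.congr_fun hc (P.mkQ y)

theorem isUnit_of_forall_sub_smul_mem [Module.Finite R M] {c : R} (hc : IsUnit c)
    (he : ∀ y, e y - c • y ∈ maximalIdeal R • (⊤ : Submodule R M)) : IsUnit e := by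
  have hsup : (⊤ : Submodule R M) ≤ LinearMap.range e ⊔ maximalIdeal R • ⊤ := fun y _ ↦ by
    refine (Submodule.smul_mem_iff_of_isUnit _ hc).1 ?_
    rw [← sub_sub_self (e y) (c • y)]
    exact sub_mem (Submodule.mem_sup_left (LinearMap.mem_range_self e y))
      (Submodule.mem_sup_right (he y))
  have hsurj : Function.Surjective e := LinearMap.range_eq_top.1 <| top_le_iff.1 <|
    Submodule.le_of_le_smul_of_le_jacobson_bot Module.Finite.fg_top (maximalIdeal_le_jacobson _)
      hsup
  exact (Module.End.isUnit_iff e).2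
    ⟨OrzechProperty.injective_of_surjective_endomorphism e hsurj, hsurj⟩

end ScalarResidue

theorem IsGorensteinRing.exists_hasInjectiveDimensionLE_of_isLocalRing (S : Type u) [CommRing S]
    [IsLocalRing S] [IsGorensteinRing S] :
    ∃ d : ℕ, HasInjectiveDimensionLE (ModuleCat.of S S) d := by
  obtain ⟨d, hd⟩ :=
    (IsGorensteinRing.localization_atPrime (maximalIdeal S)).exists_hasInjectiveDimensionLE
  have hunits : (maximalIdeal S).primeCompl ≤ IsUnit.submonoid S := fun a ha ↦ by
    exact notMem_maximalIdeal.1 ha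
  let e : S ≃+* Localization.AtPrime (maximalIdeal S) :=
    (IsLocalization.atUnits S (maximalIdeal S).primeCompl hunits).toRingEquiv
  have := RingHomInvPair.of_ringEquiv e
  have := RingHomInvPair.of_ringEquiv e.symm
  let L := Localization.AtPrime (maximalIdeal S)
  let E : ModuleCat.of S S ≃ₛₗ[RingHomClass.toRingHom e] ModuleCat.of L L :=
    { e with map_smul' := fun a b ↦ map_mul e a b }
  exact ⟨d, (ModuleCat.hasInjectiveDimensionLE_iff_of_semiLinearEquiv e E d).2 hd⟩

section Homotheties

variable {R E M : Type*} [CommRing R] [CommRing E] [Algebra R E] [AddCommGroup M] [Module R M]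
  [Module E M] [IsScalarTower R E M]

theorem lsmul_mem_center
    (hE : Function.Surjective (Algebra.lsmul R R M : E →ₐ[R] Module.End R M)) (a : E) :
    Algebra.lsmul R R M a ∈ Subring.center (Module.End R M) := by
  refine Subring.mem_center_iff.2 fun f ↦ ?_
  obtain ⟨b, rfl⟩ := hE f
  rw [← map_mul, ← map_mul, mul_comm]

theorem bijective_algebraMap_end_of_bijective_lsmul
    (hE : Function.Bijective (Algebra.lsmul R R M : E →ₐ[R] Module.End R M)) :
    Function.Bijective (algebraMap E (Module.End E M)) := by
  refine ⟨fun a b hab ↦ hE.1 (LinearMap.ext fun y ↦ LinearMap.congr_fun hab y), fun g ↦ ?_⟩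
  obtain ⟨a, ha⟩ := hE.2 (g.restrictScalars R)
  exact ⟨a, LinearMap.ext fun y ↦ LinearMap.congr_fun ha y⟩

variable (E) (x : R)

theorem isArtinianRing_quotient_span_algebraMap [Module.Finite R E]
    [IsArtinianRing (R ⧸ Ideal.span {x})] : IsArtinianRing (E ⧸ Ideal.span {algebraMap R E x}) := by
  rw [← Set.image_singleton, ← Ideal.map_span]
  have : Module.Finite (R ⧸ Ideal.span {x}) (E ⧸ (Ideal.span {x}).map (algebraMap R E)) :=
    .of_restrictScalars_finite R _ _
  exact .of_finite (R ⧸ Ideal.span {x}) _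

variable (M) in
theorem not_isUnit_algebraMap [Nontrivial (QuotSMulTop x M)] : ¬ IsUnit (algebraMap R E x) := by
  rintro ⟨a, ha⟩
  refine (Submodule.Quotient.nontrivial_iff (p := x • (⊤ : Submodule R M))).1 inferInstance ?_
  refine Submodule.eq_top_iff'.2 fun y ↦ ?_
  have hy : x • (↑a⁻¹ : E) • y = y := by
    rw [← algebraMap_smul E x, ← ha, smul_smul, a.mul_inv, one_smul]
  exact hy ▸ Submodule.smul_mem_pointwise_smul _ x ⊤ Submodule.mem_top

end Homotheties

section EndomorphismRing

variable {R E M : Type u} [CommRing R] [IsLocalRing R] [CommRing E] [Algebra R E]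
  [AddCommGroup M] [Module R M] [Module.Finite R M] [Module E M] [IsScalarTower R E M] {x : R}

theorem IsRigidModule.isLocalRing_of_bijective_lsmul (hrigid : IsRigidModule R M)
    (hx : IsSMulRegular M x) [Nontrivial (QuotSMulTop x M)] [IsArtinian R (QuotSMulTop x M)]
    (hE : Function.Bijective (Algebra.lsmul R R M : E →ₐ[R] Module.End R M)) : IsLocalRing E := by
  have isUnit_of_scalar {a : E} {c : R} (hc : IsUnit c)
      (ha : ∀ y : M, a • y - c • y ∈ maximalIdeal R • (⊤ : Submodule R M)) : IsUnit a :=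
    (isUnit_map_iff (AlgEquiv.ofBijective _ hE) a).1 (isUnit_of_forall_sub_smul_mem hc ha)
  have hMQ : Function.Surjective (x • (⊤ : Submodule R M)).mkQ := Submodule.mkQ_surjective _
  have : Nontrivial M := hMQ.nontrivial
  have : Nontrivial E := Module.nontrivial E M
  refine .of_isUnit_or_isUnit_one_sub_self fun a ↦ ?_
  obtain ⟨c, hc⟩ := exists_sub_smul_mem_of_forall_apply_mem_span_singleton_sup
    (hrigid.apply_mem_span_singleton_sup hx (lsmul_mem_center hE.2 a))
  refine (isUnit_or_isUnit_one_sub_self c).imp (fun h ↦ isUnit_of_scalar h hc) fun h ↦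
    isUnit_of_scalar h fun y ↦ ?_
  have hneg : (1 - a) • y - (1 - c) • y = -(a • y - c • y) := by
    rw [sub_smul, sub_smul, one_smul, one_smul]; abel
  exact hneg ▸ neg_mem (hc y)

variable [IsNoetherianRing R]

theorem IsRigidModule.isPrincipal_top_of_isGorensteinRing [IsGorensteinRing E]
    (hrigid : IsRigidModule R M) (hxm : x ∈ maximalIdeal R) [IsArtinianRing (R ⧸ Ideal.span {x})]
    (hx : IsSMulRegular M x)
    (hE : Function.Bijective (Algebra.lsmul R R M : E →ₐ[R] Module.End R M)) :
    (⊤ : Submodule R M).IsPrincipal := by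
  obtain _ | _ := subsingleton_or_nontrivial M
  · exact Subsingleton.elim ⊥ (⊤ : Submodule R M) ▸ inferInstance
  have : Nontrivial (QuotSMulTop x M) := nontrivial_quotSMulTop_of_mem_maximalIdeal M hxm
  have : IsArtinian R (QuotSMulTop x M) := isArtinian_quotSMulTop x M
  have : IsLocalRing E := hrigid.isLocalRing_of_bijective_lsmul hx hE
  have : Module.Finite R E := .equiv (AlgEquiv.ofBijective _ hE).symm.toLinearEquiv
  have : Module.Finite E M := .of_restrictScalars_finite R E M
  obtain ⟨d, hd⟩ := IsGorensteinRing.exists_hasInjectiveDimensionLE_of_isLocalRing E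
  have hxM : IsSMulRegular M (algebraMap R E x) := (isSMulRegular_algebraMap_iff E).2 hx
  have hxE : IsSMulRegular E (algebraMap R E x) := fun a b hab ↦
    hE.1 <| LinearMap.ext fun y ↦ hxM <| by simpa [mul_smul] using congrArg (· • y) hab
  have := isArtinianRing_quotient_span_algebraMap E x
  obtain ⟨m, hm⟩ := exists_span_singleton_eq_top_of_bijective_algebraMap_end hxE
    (not_isUnit_algebraMap E M x) d hxM (bijective_algebraMap_end_of_bijective_lsmul hE)
  have htop : (⊤ : Submodule R M) ≤ R ∙ m ⊔ maximalIdeal R • ⊤ := fun y _ ↦ by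
    obtain ⟨a, rfl⟩ := Submodule.mem_span_singleton.1 (hm ▸ Submodule.mem_top : y ∈ E ∙ m)
    exact hrigid.apply_mem_span_singleton_sup hx (lsmul_mem_center hE.2 a) m
  exact ⟨m, (top_le_iff.1 <| Submodule.le_of_le_smul_of_le_jacobson_bot Module.Finite.fg_top
    (maximalIdeal_le_jacobson _) htop).symm⟩

end EndomorphismRing

theorem proposition4p7_general (R : Type u) [CommRing R] [IsLocalRing R] [IsNoetherianRing R]
    (hdim : ringKrullDim R ≤ 1) (I : Ideal R) (hI : ∃ x ∈ I, x ∈ nonZeroDivisors R)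
    (hrigid : IsRigidModule R I)
    (hEnd : @IsGorensteinRing (Module.End R I) (Ideal.endCommRing I hI)) : I.IsPrincipal := by
  obtain ⟨x, hxI, hx⟩ := id hI
  by_cases hxm : x ∈ maximalIdeal R
  · let : CommRing (Module.End R I) := Ideal.endCommRing I hI
    have : Ring.KrullDimLE 1 R := Ring.krullDimLE_iff.2 hdim
    have hfl : IsFiniteLength R (R ⧸ Ideal.span {x}) := isFiniteLength_quotient_span_singleton R hx
    have : IsArtinian R (R ⧸ Ideal.span {x}) := (isFiniteLength_iff_isNoetherian_isArtinian.1 hfl).2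
    have : IsArtinianRing (R ⧸ Ideal.span {x}) := isArtinian_of_tower R this
    have hxreg : IsSMulRegular I x := fun y z hyz ↦ Subtype.ext <|
      (mul_cancel_left_mem_nonZeroDivisors hx).1 (congrArg Subtype.val hyz)
    have htop : (⊤ : Submodule R I).IsPrincipal :=
      hrigid.isPrincipal_top_of_isGorensteinRing (E := Module.End R I) hxm hxreg
        Function.bijective_id
    exact Submodule.map_subtype_top I ▸ htop.map I.subtype
  · rw [I.eq_top_of_isUnit_mem hxI (notMem_maximalIdeal.1 hxm)]
    infer_instance

theorem proposition4p7 (R : Type u) [CommRing R] [IsGorensteinLocalRing R]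
    (hdim : ringKrullDim R = 1) (I : Ideal R) (hI : ∃ x ∈ I, x ∈ nonZeroDivisors R)
    (hrigid : IsRigidModule R I)
    (hEnd : @IsGorensteinRing (Module.End R I) (Ideal.endCommRing I hI)) :
    I.IsPrincipal :=
  proposition4p7_general R hdim.le I hI hrigid hEnd
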